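/- Let $K$ be an algebraically closed field of characteristic zero (for example $K=\mathbb{C}$), let $n\ge 3$, let $m_1,\dots,m_n\ge 0$ be integers, put $A^{(i)}:=K^{m_i}$, and let $T\in A^{(1)}\otimes\cdots\otimes A^{(n)}$. The codimension of a nonempty subset $S$ of an affine space $V\cong K^N$ is $N-\dim S$, where $\dim S$ is the dimension of the Zariski closure of $S$. For any $k\ge 2$ and any $k$-part tensor $U\in B^{(1)}\otimes\cdots\otimes B^{(k)}$ with finite-dimensional $B^{(1)},\dots,B^{(k)}$, regarded as a multilinear function on $B^{(1)*}\times\cdots\times B^{(k)*}$, the geometric rank is $$\mathrm{GR}(U):=\mathrm{codim}\{(x_1,\dots,x_{k-1})\in B^{(1)*}\times\cdots\times B^{(k-1)*}\mid U(x_1,\dots,x_{k-1},x_k)=0\ \text{ for all } x_k\in B^{(k)*}\},$$ the codimension being taken in $B^{(1)*}\times\cdots\times B^{(k-1)*}$. For $1\le i\le n$ and $x\in A^{(i)*}$ let $T(x)\in\bigotimes_{k\ne i}A^{(k)}$ (the remaining factors in their original order) be the $(n-1)$-part tensor obtained by inserting $x$ into the $i$-th argument of $T$, and for an integer $j\ge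 0$ put $$A^{(i)*}_j:=\{x\in A^{(i)*}\mid \mathrm{GR}(T(x))\le j\}.$$ Then: 1. $\mathrm{GR}(T)$ is invariant under every permutation of the $n$ factors: for every permutation $\sigma$ of $\{1,\dots,n\}$, the tensor obtained from $T$ by permuting its factors by $\sigma$ has the same geometric rank as $T$. 2. For every $1\le i\le n$, $$\mathrm{GR}(T)=\min\bigl\{\mathrm{codim}(A^{(i)*}_j)+j \;\bigm|\; 0\le j\le \min_{k\ne i} m_k\bigr\},$$ where the codimension is taken in $A^{(i)*}$. -/

import Mathlib

open scoped TensorProduct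

noncomputable section

/-- The dimension of a subset `S` of the affine space `K^ι`: the Krull dimension of the coordinate
ring `K[X_ι] / I(S)`, where `I(S)` is the ideal of all polynomials vanishing on `S`. It equals the
dimension of the Zariski closure of `S`, and it is `⊥` exactly for `S = ∅`. -/
def affineDim {K : Type*} [Field K] {ι : Type*} (S : Set (ι → K)) : WithBot ℕ∞ :=
  ringKrullDim (MvPolynomial ι K ⧸ MvPolynomial.vanishingIdeal K S)

/-- The codimension of a nonempty subset `S` of the affine space `K^ι`, that is
`dim K^ι - dim S`; see `affineDim_add_affineCodim`. -/
def affineCodim {K : Type*} [Field K] {ι : Type*} [Fintype ι] (S : Set (ι → K)) : ℕ :=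
  Fintype.card ι - ((affineDim S).unbotD 0).toNat

/-- For nonempty `S` the subtraction in `affineCodim` is a genuine one. -/
theorem affineDim_add_affineCodim {K : Type*} [Field K] {ι : Type*} [Fintype ι]
    {S : Set (ι → K)} (hS : S.Nonempty) :
    affineDim S + (affineCodim S : WithBot ℕ∞) = (Fintype.card ι : WithBot ℕ∞) := by
  have hle : affineDim S ≤ (Fintype.card ι : WithBot ℕ∞) := by
    refine (ringKrullDim_quotient_le _).trans ?_
    rw [MvPolynomial.ringKrullDim_of_isNoetherianRing, ringKrullDim_eq_zero_of_field, zero_add,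
      Nat.card_eq_fintype_card]
  have hne : Nontrivial (MvPolynomial ι K ⧸ MvPolynomial.vanishingIdeal K S) := by
    rw [Ideal.Quotient.nontrivial_iff, Ideal.ne_top_iff_one]
    intro h
    obtain ⟨x, hx⟩ := hS
    simpa using h x hx
  have h0 : (0 : WithBot ℕ∞) ≤ affineDim S := ringKrullDim_nonneg_of_nontrivial
  unfold affineCodim
  generalize affineDim S = d at *
  induction d using WithBot.recBotCoe with
  | bot => simp at h0
  | coe d =>
    induction d using WithTop.recTopCoe with
    | top => exact absurd hle (not_le_of_gt (WithBot.coe_lt_coe.2 (ENat.natCast_lt_top _)))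
    | coe d =>
      have hd : d ≤ Fintype.card ι := by
        have h := WithBot.coe_le_coe.1 hle
        exact ENat.natCast_le_natCast.1 h
      change ((d : ℕ) : WithBot ℕ∞) + ((Fintype.card ι - d : ℕ) : WithBot ℕ∞) = _
      rw [← Nat.cast_add, Nat.add_sub_cancel' hd]

/-- A tensor `T ∈ K^{m_1} ⊗ ⋯ ⊗ K^{m_n}` regarded as a multilinear function on
`(K^{m_1})^* × ⋯ × (K^{m_n})^*`. An element of `(K^{m_i})^*` is given by its coordinates `x i` in
the dual basis, that is, it is the functional `a ↦ x i ⬝ᵥ a`. On pure tensors,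
`(a_1 ⊗ ⋯ ⊗ a_n)(x_1, …, x_n) = ∏ i, x_i(a_i)`. -/
def tensorForm {K : Type*} [Field K] {n : ℕ} {m : Fin n → ℕ}
    (T : ⨂[K] i, (Fin (m i) → K)) : MultilinearMap K (fun i => Fin (m i) → K) K where
  toFun x := PiTensorProduct.lift
    ((MultilinearMap.mkPiAlgebra K (Fin n) K).compLinearMap
      fun i => dotProductBilin K K (x i)) T
  map_update_add' x i y z := by
    rw [← LinearMap.add_apply, ← map_add]
    refine congrArg (fun φ => PiTensorProduct.lift φ T) ?_
    refine MultilinearMap.ext fun a => ?_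
    simpa only [add_apply, smul_apply,
      MultilinearMap.compLinearMap_apply, LinearMap.flip_apply] using
      ((MultilinearMap.mkPiAlgebra K (Fin n) K).compLinearMap
        fun i => (dotProductBilin K K).flip (a i)).map_update_add x i y z
  map_update_smul' x i c y := by
    rw [← LinearMap.smul_apply, ← map_smul]
    refine congrArg (fun φ => PiTensorProduct.lift φ T) ?_
    refine MultilinearMap.ext fun a => ?_
    simpa only [add_apply, smul_apply,
      MultilinearMap.compLinearMap_apply, LinearMap.flip_apply] using
      ((MultilinearMap.mkPiAlgebra K (Fin n) K).compLinearMap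
        fun i => (dotProductBilin K K).flip (a i)).map_update_smul x i c y

theorem tensorForm_tprod {K : Type*} [Field K] {n : ℕ} {m : Fin n → ℕ}
    (a x : ∀ i, Fin (m i) → K) :
    tensorForm (PiTensorProduct.tprod K a) x = ∏ i, x i ⬝ᵥ a i := by
  simp [tensorForm, dotProductBilin]

/-- For an `(n + 1)`-part tensor, given as a multilinear function `F`, this is the set of all
`(x_1, …, x_n)` such that `F (x_1, …, x_n, y) = 0` for all `y`, a subset of the affine space with
coordinates `x_{k,a}`, the product of the duals of the first `n` factors. -/
def tensorZeroSet {K : Type*} [Field K] {n : ℕ} {m : Fin (n + 1) → ℕ}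
    (F : MultilinearMap K (fun i => Fin (m i) → K) K) :
    Set ((Σ k : Fin n, Fin (m k.castSucc)) → K) :=
  {x | ∀ y : Fin (m (Fin.last n)) → K,
    F (Fin.snoc (α := fun i => Fin (m i) → K) (fun k a => x ⟨k, a⟩) y) = 0}

/-- The geometric rank of a tensor with at least two factors (then `tensorZeroSet F` contains `0`,
hence is nonempty). -/
def geometricRank {K : Type*} [Field K] {n : ℕ} {m : Fin (n + 1) → ℕ}
    (F : MultilinearMap K (fun i => Fin (m i) → K) K) : ℕ :=
  affineCodim (tensorZeroSet F)

/-- The locus `A^{(i)*}_j` of all `x` in the dual of the `i`-th factor for which the contraction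
`F (…, x, …)`, with `x` inserted at the `i`-th place, has geometric rank at most `j` as a tensor in
the remaining factors. -/
def contractionLocus {K : Type*} [Field K] {n : ℕ} {m : Fin (n + 2) → ℕ}
    (F : MultilinearMap K (fun i => Fin (m i) → K) K) (i : Fin (n + 2)) (j : ℕ) :
    Set (Fin (m i) → K) :=
  {x | geometricRank (m := fun k => m (i.succAbove k)) (F.curryMid i x) ≤ j}

end

/-!
The proof rests on a combinatorial description of dimension. For a subset `S` of the affine space
`K^ι`, the dimension of the closure of `S` is the largest size of a set of coordinates along which
`S` projects to a Zariski-dense set; this is `exists_denseProj_affineCodim` together with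
`DenseProj.affineCodim_add_card_le`. Behind it stands the fact that the Krull dimension of an affine
domain is its transcendence degree, and that a transcendence basis can be chosen among the
coordinate functions.

With this description, dimensions of total spaces are compared with dimensions of fibres.
For `Z ⊆ K^ι × K^κ` with fibres `Z_w ⊆ K^κ`, dense projections of the base and of the fibres add up
to a dense projection of `Z` (`DenseProj.sum_map`). Conversely, if `Z` is closed, a transcendence
basis of the coordinate ring of a component can be taken to extend a transcendence basis of the
subring generated by the coordinates of the base. By Chevalley's theorem a generic value of this
basis lifts to a point of `Z`, and only finitely many points of the base lie over a generic value of
its first part, so that one of the corresponding fibres must project densely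
(`exists_denseProj_setOf_denseProj`). Hence, when `Z` is closed and all its fibres are nonempty,
`codim Z = min_j (codim {w | codim Z_w ≤ j} + j)`, which is `isLeast_affineCodim_add`.

For a multilinear form `F` with arguments indexed by a finite type and an argument `e`, let
`zeroSetAt F e` be the set of all `x` such that `F` vanishes at `x` whatever is put in place of
`x e`. It lives in the full affine space, so no ordering of the arguments enters, and its
codimension is the geometric rank when `e` is the last argument. Fix all arguments but `i` and `j`:
the fibres of `zeroSetAt F i` and `zeroSetAt F j` are linear spaces whose codimension is the rank of the same
bilinear form, read from its two sides. As the codimension of a closed set only depends on those of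
its fibres, `codim (zeroSetAt F e)` is independent of `e` (`affineCodim_zeroSetAt_eq`), which is
the invariance under permutations. The formula for the minimum arises from projecting
`zeroSetAt F e`, for some `e ≠ i`, to the `i`-th argument, since the fibre over `x` is the
corresponding zero set of the contraction by `x`. The index `j` can be bounded because the geometric
rank of the contraction is at most the dimension of each of its factors (`geometricRank_le`).
-/

/-! ### Transcendence bases and Krull dimension of affine algebras -/

section KrullDim

/-- Integral extensions preserve the Krull dimension: contraction of primes is strictly monotone,
and chains of primes lift by going up. -/
theorem ringKrullDim_eq_of_isIntegral (R S : Type*) [CommRing R] [CommRing S] [Algebra R S]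
    [Algebra.IsIntegral R S] [FaithfulSMul R S] : ringKrullDim S = ringKrullDim R := by
  refine le_antisymm (Order.krullDim_le_of_strictMono (PrimeSpectrum.comap (algebraMap R S))
    fun I J h => Ideal.IsIntegral.comap_lt_comap (R := R) h) (iSup_le fun l => ?_)
  obtain ⟨⟨P, hP, hl⟩⟩ := Ideal.nonempty_primesOver (S := S) l.head.asIdeal
  obtain ⟨L, hL, -, -⟩ := Ideal.exists_ltSeries_of_hasGoingUp l P
  rw [← hL]
  exact Order.LTSeries.length_le_krullDim L

/-- The Krull dimension of an affine domain is its transcendence degree, by Noether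
normalization. -/
theorem ringKrullDim_eq_card_of_isTranscendenceBasis {K A α : Type*} [Field K] [CommRing A]
    [IsDomain A] [Algebra K A] [Algebra.FiniteType K A] [Fintype α] {x : α → A}
    (hx : IsTranscendenceBasis K x) : ringKrullDim A = Fintype.card α := by
  obtain ⟨n, g, hg, hi⟩ := exists_integral_inj_algHom_of_fg K A
  algebraize [g.toRingHom]
  have : Algebra.IsIntegral (MvPolynomial (Fin n) K) A := ⟨hi⟩
  have : FaithfulSMul (MvPolynomial (Fin n) K) A :=
    (faithfulSMul_iff_algebraMap_injective _ _).2 hg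
  have hb := (IsTranscendenceBasis.mvPolynomial (Fin n) K).algebraMap_comp (A := A)
  have hc := hx.lift_cardinalMk_eq hb
  rw [ringKrullDim_eq_of_isIntegral (MvPolynomial (Fin n) K),
    MvPolynomial.ringKrullDim_of_isNoetherianRing, ringKrullDim_eq_zero_of_field, zero_add]
  simp at hc
  simp [hc]

/-- A transcendence basis can be chosen inside any finite family over which the ring is
algebraic. -/
theorem exists_isTranscendenceBasis_comp {R A ι : Type*} [CommRing R] [CommRing A] [IsDomain A]
    [Algebra R A] [FaithfulSMul R A] [Finite ι] (x : ι → A)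
    [Algebra.IsAlgebraic (Algebra.adjoin R (Set.range x)) A] :
    ∃ (d : ℕ) (f : Fin d → ι), IsTranscendenceBasis R (x ∘ f) := by
  obtain ⟨t, ht, hB⟩ := exists_isTranscendenceBasis_subset (R := R) (Set.range x)
  obtain ⟨u, rfl, hinj⟩ := Set.exists_image_eq_injOn_of_subset_range ht
  rw [← isTranscendenceBasis_image hinj] at hB
  let e := Finite.equivFin u
  refine ⟨Nat.card u, fun i => (e.symm i : ι), ?_⟩
  exact (isTranscendenceBasis_equiv' (R := R) e.symm (f := fun i : u => x i) rfl).2 hB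

theorem exists_isTranscendenceBasis_comp_of_adjoin_eq_top {K A ι : Type*} [Field K] [CommRing A]
    [IsDomain A] [Algebra K A] [Finite ι] {x : ι → A}
    (h : Algebra.adjoin K (Set.range x) = ⊤) :
    ∃ (d : ℕ) (f : Fin d → ι), IsTranscendenceBasis K (x ∘ f) := by
  have : Algebra.IsAlgebraic (Algebra.adjoin K (Set.range x)) A :=
    ⟨fun a => isAlgebraic_algebraMap (⟨a, h ▸ Algebra.mem_top⟩ : Algebra.adjoin K (Set.range x))⟩
  exact exists_isTranscendenceBasis_comp x

/-- Coordinates that are independent modulo an ideal stay independent modulo some prime above it. -/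
theorem exists_isPrime_algebraicIndependent {K ι α : Type*} [Field K]
    {I : Ideal (MvPolynomial ι K)} {f : α → ι}
    (h : AlgebraicIndependent K fun i => Ideal.Quotient.mk I (MvPolynomial.X (f i))) :
    ∃ P : Ideal (MvPolynomial ι K), P.IsPrime ∧ I ≤ P ∧
      AlgebraicIndependent K fun i => Ideal.Quotient.mk P (MvPolynomial.X (f i)) := by
  have key (J : Ideal (MvPolynomial ι K)) (p : MvPolynomial α K) :
      MvPolynomial.aeval (fun i => Ideal.Quotient.mk J (MvPolynomial.X (f i))) p =
        Ideal.Quotient.mk J (MvPolynomial.rename f p) := by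
    have : MvPolynomial.aeval (fun i => Ideal.Quotient.mk J (MvPolynomial.X (f i))) =
      (Ideal.Quotient.mkₐ K J).comp (MvPolynomial.rename f) := by ext; simp
    rw [this]; rfl
  rw [algebraicIndependent_iff] at h
  simp only [key, Ideal.Quotient.eq_zero_iff_mem] at h
  -- The nonzero polynomials in the given coordinates form a multiplicative set that avoids `I`.
  obtain ⟨P, hP, hIP, hd⟩ := I.exists_le_prime_disjoint
    ((nonZeroDivisors (MvPolynomial α K)).map (MvPolynomial.rename f)) (by
      rw [Set.disjoint_left]
      rintro _ hI ⟨p, hp, rfl⟩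
      exact nonZeroDivisors.ne_zero hp (h p hI))
  refine ⟨P, hP, hIP, ?_⟩
  rw [algebraicIndependent_iff]
  simp only [key, Ideal.Quotient.eq_zero_iff_mem]
  intro p hp
  by_contra h0
  exact Set.disjoint_left.1 hd hp ⟨p, mem_nonZeroDivisors_of_ne_zero h0, rfl⟩

theorem adjoin_range_mk_X {K ι : Type*} [Field K] (I : Ideal (MvPolynomial ι K)) :
    Algebra.adjoin K (Set.range fun i => Ideal.Quotient.mk I (MvPolynomial.X i)) = ⊤ := by
  have : (Set.range fun i => Ideal.Quotient.mk I (MvPolynomial.X i)) =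
      (Ideal.Quotient.mkₐ K I) '' Set.range MvPolynomial.X := by
    rw [← Set.range_comp]; rfl
  rw [this, ← AlgHom.map_adjoin, MvPolynomial.adjoin_range_X, Algebra.map_top,
    AlgHom.range_eq_top]
  exact Ideal.Quotient.mkₐ_surjective _ _

theorem card_le_ringKrullDim_quotient {K ι α : Type*} [Field K] [Finite ι] [Fintype α]
    {I : Ideal (MvPolynomial ι K)} {f : α → ι}
    (h : AlgebraicIndependent K fun i => Ideal.Quotient.mk I (MvPolynomial.X (f i))) :
    (Fintype.card α : WithBot ℕ∞) ≤ ringKrullDim (MvPolynomial ι K ⧸ I) := by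
  obtain ⟨P, hP, hIP, hi⟩ := exists_isPrime_algebraicIndependent h
  obtain ⟨d, g, hg⟩ := exists_isTranscendenceBasis_comp_of_adjoin_eq_top (adjoin_range_mk_X P)
  refine le_trans ?_ (ringKrullDim_le_of_surjective (Ideal.Quotient.factor hIP)
    (Ideal.Quotient.factor_surjective hIP))
  rw [ringKrullDim_eq_card_of_isTranscendenceBasis hg]
  have h1 := hi.lift_cardinalMk_le_trdeg
  have h2 := hg.lift_cardinalMk_eq_trdeg
  simp at h1 h2
  rw [← h2] at h1
  simp at h1
  simpa using h1

theorem exists_algebraicIndependent_of_le_ringKrullDim {K A ι : Type*} [Field K] [CommRing A]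
    [Algebra K A] [Algebra.FiniteType K A] [Finite ι] {x : ι → A}
    (hx : Algebra.adjoin K (Set.range x) = ⊤) {n : ℕ} (hn : (n : WithBot ℕ∞) ≤ ringKrullDim A) :
    ∃ (d : ℕ) (f : Fin d → ι), n ≤ d ∧ AlgebraicIndependent K (x ∘ f) := by
  obtain ⟨l, hl⟩ := Order.le_krullDim_iff.1 (show (n : WithBot ℕ∞) ≤
    Order.krullDim (PrimeSpectrum A) from hn)
  let q := l.head
  -- A longest chain of primes lives above its smallest member, so passing to that quotient loses
  -- nothing and reduces to a domain.
  have hq : (n : WithBot ℕ∞) ≤ ringKrullDim (A ⧸ q.asIdeal) := by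
    rw [ringKrullDim_quotient]
    have : PrimeSpectrum.zeroLocus (q.asIdeal : Set A) = Set.Ici q := by
      ext p; simp [PrimeSpectrum.mem_zeroLocus, ← PrimeSpectrum.asIdeal_le_asIdeal]
    rw [this, ← Order.coheight_eq_krullDim_Ici, ← hl]
    exact WithBot.coe_le_coe.2 (Order.length_le_coheight_head (p := l))
  have htop : Algebra.adjoin K (Set.range (Ideal.Quotient.mkₐ K q.asIdeal ∘ x)) = ⊤ := by
    rw [Set.range_comp, ← AlgHom.map_adjoin, hx, Algebra.map_top, AlgHom.range_eq_top]
    exact Ideal.Quotient.mkₐ_surjective _ _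
  obtain ⟨d, f, hf⟩ := exists_isTranscendenceBasis_comp_of_adjoin_eq_top htop
  refine ⟨d, f, ?_, AlgebraicIndependent.of_comp (Ideal.Quotient.mkₐ K q.asIdeal) hf.1⟩
  rw [ringKrullDim_eq_card_of_isTranscendenceBasis hf] at hq
  simpa using hq

/-- The Krull dimension of `K[X]/I` is attained by a set of coordinates that are independent modulo
`I`. -/
theorem exists_ringKrullDim_quotient_eq {K ι : Type*} [Field K] [Finite ι]
    {I : Ideal (MvPolynomial ι K)} (hI : I ≠ ⊤) :
    ∃ (d : ℕ) (f : Fin d → ι),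
      AlgebraicIndependent K (fun i => Ideal.Quotient.mk I (MvPolynomial.X (f i))) ∧
      ringKrullDim (MvPolynomial ι K ⧸ I) = d := by
  have hnt : Nontrivial (MvPolynomial ι K ⧸ I) := Ideal.Quotient.nontrivial_iff.2 hI
  have hle : ringKrullDim (MvPolynomial ι K ⧸ I) ≤ (Nat.card ι : WithBot ℕ∞) := by
    refine (ringKrullDim_quotient_le _).trans ?_
    rw [MvPolynomial.ringKrullDim_of_isNoetherianRing, ringKrullDim_eq_zero_of_field, zero_add]
  have h0 : (0 : WithBot ℕ∞) ≤ ringKrullDim (MvPolynomial ι K ⧸ I) :=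
    ringKrullDim_nonneg_of_nontrivial
  obtain ⟨n, hn⟩ : ∃ n : ℕ, ringKrullDim (MvPolynomial ι K ⧸ I) = n := by
    generalize ringKrullDim (MvPolynomial ι K ⧸ I) = d at *
    induction d using WithBot.recBotCoe with
    | bot => simp at h0
    | coe d =>
      induction d using WithTop.recTopCoe with
      | top => exact absurd hle (not_le_of_gt (WithBot.coe_lt_coe.2 (ENat.natCast_lt_top _)))
      | coe d => exact ⟨d, rfl⟩
  obtain ⟨d, f, hnd, hf⟩ :=
    exists_algebraicIndependent_of_le_ringKrullDim (adjoin_range_mk_X I) hn.ge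
  refine ⟨d, f, hf, le_antisymm ?_ (by simpa using card_le_ringKrullDim_quotient hf)⟩
  rw [hn]
  exact_mod_cast hnd

end KrullDim

/-! ### Dense coordinate projections -/

open MvPolynomial in
/-- The projection `x ↦ x ∘ f` maps `S` to a Zariski-dense subset of `K^α`: no nonzero polynomial in
the coordinates `f i` vanishes on `S`. A family of indices is used rather than a set of them, so
that projections of a base and of its fibres combine through `Sum.map`; density forces `f` to be
injective. -/
def DenseProj {K ι α : Type*} [Field K] (S : Set (ι → K)) (f : α → ι) : Prop :=
  ∀ p : MvPolynomial α K, (∀ x ∈ S, eval (x ∘ f) p = 0) → p = 0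

section DenseProj

open MvPolynomial

variable {K ι κ α β : Type*} [Field K]

theorem denseProj_iff_algebraicIndependent {S : Set (ι → K)} {f : α → ι} :
    DenseProj S f ↔
      AlgebraicIndependent K fun i => Ideal.Quotient.mk (vanishingIdeal K S) (X (f i)) := by
  have key : aeval (fun i => Ideal.Quotient.mk (vanishingIdeal K S) (X (f i))) =
      (Ideal.Quotient.mkₐ K (vanishingIdeal K S)).comp (rename f) := by ext; simp
  rw [algebraicIndependent_iff, key]
  refine forall_congr' fun p => imp_congr_left ?_
  rw [AlgHom.comp_apply, Ideal.Quotient.mkₐ_eq_mk, Ideal.Quotient.eq_zero_iff_mem,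
    mem_vanishingIdeal_iff]
  simp [aeval_rename]

theorem DenseProj.mono {S T : Set (ι → K)} {f : α → ι} (h : DenseProj S f) (hST : S ⊆ T) :
    DenseProj T f :=
  fun p hp => h p fun x hx => hp x (hST hx)

theorem DenseProj.nonempty {S : Set (ι → K)} {f : α → ι} (h : DenseProj S f) : S.Nonempty := by
  by_contra hS
  rw [Set.not_nonempty_iff_eq_empty] at hS
  exact one_ne_zero (h 1 (by simp [hS]))

/-- If a finite union projects densely, then so does one of its members. The product of polynomials
witnessing the contrary would vanish on the union. -/
theorem DenseProj.exists_of_iUnion [Finite β] {S : β → Set (ι → K)} {f : α → ι}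
    (h : DenseProj (⋃ b, S b) f) : ∃ b, DenseProj (S b) f := by
  have := Fintype.ofFinite β
  by_contra! hc
  simp only [DenseProj, not_forall] at hc
  choose p hp hp0 using hc
  refine Finset.prod_ne_zero_iff.2 (fun b _ => hp0 b) (h (∏ b, p b) fun x hx => ?_)
  obtain ⟨b, hb⟩ := Set.mem_iUnion.1 hx
  rw [map_prod]
  exact Finset.prod_eq_zero (Finset.mem_univ b) (hp b x hb)

/-- A nonempty set projects densely along as many coordinates as its dimension; with
`DenseProj.affineCodim_add_card_le`, this number is the largest possible. -/
theorem exists_denseProj_affineCodim [Fintype ι] {S : Set (ι → K)} (hS : S.Nonempty) :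
    ∃ (d : ℕ) (f : Fin d → ι), DenseProj S f ∧ affineDim S = d ∧
      affineCodim S + d = Fintype.card ι := by
  obtain ⟨d, f, hf, hd⟩ := exists_ringKrullDim_quotient_eq (I := vanishingIdeal K S) (by
    rw [Ideal.ne_top_iff_one]
    intro h
    obtain ⟨x, hx⟩ := hS
    simpa using h x hx)
  refine ⟨d, f, denseProj_iff_algebraicIndependent.2 hf, hd, ?_⟩
  have h := affineDim_add_affineCodim hS
  rw [affineDim, hd] at h
  rw [add_comm]
  exact_mod_cast h

theorem DenseProj.affineCodim_add_card_le [Fintype ι] [Fintype α] {S : Set (ι → K)} {f : α → ι}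
    (h : DenseProj S f) : affineCodim S + Fintype.card α ≤ Fintype.card ι := by
  obtain ⟨d, -, -, hd, hcd⟩ := exists_denseProj_affineCodim h.nonempty
  have h2 := card_le_ringKrullDim_quotient (denseProj_iff_algebraicIndependent.1 h)
  rw [← affineDim, hd] at h2
  have : Fintype.card α ≤ d := by exact_mod_cast h2
  omega

/-- A polynomial in two groups of variables, seen as a polynomial in the second group with
coefficients in the first. -/
theorem exists_sum_mvPolynomial_equiv (K α β : Type*) [Field K] :
    ∃ e : MvPolynomial (α ⊕ β) K ≃+* MvPolynomial β (MvPolynomial α K),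
      ∀ (a : α → K) (b : β → K) (p : MvPolynomial (α ⊕ β) K),
        eval (Sum.elim a b) p = eval b (map (eval a) (e p)) := by
  refine ⟨((renameEquiv K (Equiv.sumComm α β)).trans (sumAlgEquiv K β α)).toRingEquiv, ?_⟩
  intro a b p
  induction p using MvPolynomial.induction_on with
  | C r => simp
  | add p q hp hq => simp only [map_add, hp, hq]
  | mul_X p i hp =>
    rw [map_mul, hp, map_mul, map_mul, map_mul]
    congr 1
    cases i <;> simp

/-- If the fibres of `Z` over all points of `S` project densely along `g`, and `S` projects densely
along `f`, then `Z` projects densely along `f` and `g` together. -/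
theorem DenseProj.sum_map {Z : Set (ι ⊕ κ → K)} {S : Set (ι → K)} {f : α → ι} {g : β → κ}
    (hS : DenseProj S f) (hZ : ∀ w ∈ S, DenseProj {y | Sum.elim w y ∈ Z} g) :
    DenseProj Z (Sum.map f g) := by
  intro p hp
  obtain ⟨e, he⟩ := exists_sum_mvPolynomial_equiv K α β
  rw [← map_eq_zero_iff e e.injective]
  ext m : 1
  rw [coeff_zero]
  refine hS _ fun w hw => ?_
  rw [← coeff_map, hZ w hw (map (eval (w ∘ f)) (e p)), coeff_zero]
  intro y hy
  rw [← he, ← hp _ hy, Sum.elim_comp_map]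

/-- Chevalley's theorem for points: generic values of algebraically independent elements of an
affine domain are the values at some `K`-point. -/
theorem exists_ne_zero_forall_exists_algHom {A : Type*} [IsAlgClosed K] [CommRing A] [IsDomain A]
    [Algebra K A] [Algebra.FiniteType K A] [Finite α] {x : α → A}
    (hx : AlgebraicIndependent K x) :
    ∃ g : MvPolynomial α K, g ≠ 0 ∧
      ∀ c : α → K, eval c g ≠ 0 → ∃ φ : A →ₐ[K] K, ∀ i, φ (x i) = c i := by
  let f : MvPolynomial α K →+* A := (aeval x).toRingHom
  have hf : f.FinitePresentation := by
    rw [← RingHom.FinitePresentation.of_finiteType]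
    refine RingHom.FiniteType.of_comp_finiteType (f := algebraMap K _) ?_
    have : f.comp (algebraMap K (MvPolynomial α K)) = algebraMap K A := by ext; simp [f]
    rw [this]
    exact RingHom.finiteType_algebraMap.2 inferInstance
  -- The image on prime spectra is constructible and contains the generic point, so it contains a
  -- nonempty basic open set.
  obtain ⟨s, hs⟩ := PrimeSpectrum.exists_constructibleSetData_iff.2
    (PrimeSpectrum.isConstructible_range_comap hf)
  have hbot : (⊥ : PrimeSpectrum (MvPolynomial α K)) ∈ s.toSet := by
    rw [hs]
    refine ⟨⊥, ?_⟩
    ext p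
    have := map_eq_zero_iff (aeval x : MvPolynomial α K →ₐ[K] A) (x := p) hx
    simpa [f] using this
  simp only [PrimeSpectrum.ConstructibleSetData.toSet, Set.mem_iUnion] at hbot
  obtain ⟨D, hD, hCb⟩ := hbot
  simp only [PrimeSpectrum.BasicConstructibleSetData.toSet, Set.mem_sdiff,
    PrimeSpectrum.mem_zeroLocus] at hCb
  refine ⟨D.f, by simpa using hCb.2, fun c hc => ?_⟩
  let ψ : MvPolynomial α K →+* K := eval c
  have hmem : (⟨RingHom.ker ψ, RingHom.ker_isPrime ψ⟩ : PrimeSpectrum (MvPolynomial α K)) ∈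
      Set.range (PrimeSpectrum.comap f) := by
    rw [← hs]
    simp only [PrimeSpectrum.ConstructibleSetData.toSet, Set.mem_iUnion]
    refine ⟨D, hD, ?_, by simpa [ψ] using hc⟩
    refine hCb.1.trans (by simp)
  obtain ⟨P, hP⟩ := hmem
  have hPk : P.asIdeal.comap f = RingHom.ker ψ := congrArg PrimeSpectrum.asIdeal hP
  -- A maximal ideal above the prime over `c` still lies over `c`, and its residue field is `K`.
  obtain ⟨M, hM, hPM⟩ := P.asIdeal.exists_le_maximal P.2.ne_top
  let : Field (A ⧸ M) := Ideal.Quotient.field M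
  have : Module.Finite K (A ⧸ M) := finite_of_finite_type_of_isJacobsonRing K (A ⧸ M)
  let φ : A →ₐ[K] K := (IsAlgClosed.lift : (A ⧸ M) →ₐ[K] K).comp (Ideal.Quotient.mkₐ K M)
  refine ⟨φ, fun i => ?_⟩
  have hmem : (X i - C (c i) : MvPolynomial α K) ∈ P.asIdeal.comap f := by
    rw [hPk]; simp [ψ, RingHom.mem_ker]
  have h0 : Ideal.Quotient.mk M (f (X i - C (c i))) = 0 :=
    Ideal.Quotient.eq_zero_iff_mem.2 (hPM hmem)
  have h1 : φ (f (X i - C (c i))) = 0 := by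
    change (IsAlgClosed.lift : (A ⧸ M) →ₐ[K] K) (Ideal.Quotient.mk M _) = 0
    rw [h0, map_zero]
  have h2 : f (X i - C (c i)) = x i - algebraMap K A (c i) := by simp [f]
  rw [h2, map_sub, sub_eq_zero, AlgHom.commutes] at h1
  exact h1

theorem AlgebraicIndependent.exists_eval₂_eq_zero {R A : Type*} [CommRing R] [CommRing A]
    [Algebra R A] {x : α → A} (hx : AlgebraicIndependent R x) {a : A}
    (ha : IsAlgebraic (Algebra.adjoin R (Set.range x)) a) :
    ∃ q : Polynomial (MvPolynomial α R), q ≠ 0 ∧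
      q.eval₂ (aeval x : MvPolynomial α R →ₐ[R] A).toRingHom a = 0 := by
  obtain ⟨q, hq0, hq⟩ := ha
  refine ⟨q.map hx.repr.toRingHom, ?_, ?_⟩
  · rw [Ne, Polynomial.map_eq_zero_iff hx.aevalEquiv.symm.injective]
    exact hq0
  · rw [Polynomial.eval₂_map, ← hq, Polynomial.aeval_def]
    congr 1
    ext r
    exact hx.aeval_repr r

end DenseProj

/-! ### Dimension of generic fibres -/

section Fibres

open MvPolynomial

variable {K ι κ α β : Type*} [Field K]

/-- A domain generated by `x` and `y` has a transcendence basis consisting of members of `x` over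
which all of `x` is algebraic, and of members of `y`. -/
theorem exists_isTranscendenceBasis_sum_elim {A : Type*} [CommRing A] [IsDomain A] [Algebra K A]
    [Finite ι] [Finite κ] {x : ι → A} {y : κ → A}
    (hxy : Algebra.adjoin K (Set.range (Sum.elim x y)) = ⊤) :
    ∃ (a b : ℕ) (f : Fin a → ι) (g : Fin b → κ),
      IsTranscendenceBasis K (Sum.elim (x ∘ f) (y ∘ g)) ∧
      ∀ i, ∃ q : Polynomial (MvPolynomial (Fin a) K), q ≠ 0 ∧
        q.eval₂ (aeval (x ∘ f) : MvPolynomial (Fin a) K →ₐ[K] A).toRingHom (x i) = 0 := by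
  -- Compose a transcendence basis of `K[x]` over `K` with one of `A` over `K[x]`.
  let S := Algebra.adjoin K (Set.range x)
  let xs : ι → S := fun i => ⟨x i, Algebra.subset_adjoin ⟨i, rfl⟩⟩
  have hxs : Algebra.adjoin K (Set.range xs) = ⊤ := by
    refine Subalgebra.map_injective (f := S.val) Subtype.val_injective ?_
    rw [AlgHom.map_adjoin, ← Set.range_comp, Algebra.map_top, Subalgebra.range_val]
    rfl
  obtain ⟨a, f, hf⟩ := exists_isTranscendenceBasis_comp_of_adjoin_eq_top hxs
  have hy : Algebra.adjoin S (Set.range y) = ⊤ := by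
    have h := Algebra.adjoin_union_eq_adjoin_adjoin K (Set.range x) (Set.range y)
    rw [← Set.Sum.elim_range, hxy] at h
    refine Subalgebra.restrictScalars_injective K ?_
    rw [← h, Subalgebra.restrictScalars_top]
  have : FaithfulSMul S A := (faithfulSMul_iff_algebraMap_injective _ _).2 Subtype.val_injective
  have : Algebra.IsAlgebraic (Algebra.adjoin S (Set.range y)) A :=
    ⟨fun a => isAlgebraic_algebraMap (⟨a, hy ▸ Algebra.mem_top⟩ : Algebra.adjoin S (Set.range y))⟩
  obtain ⟨b, g, hg⟩ := exists_isTranscendenceBasis_comp (R := S) y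
  refine ⟨a, b, f, g, ?_, fun i => ?_⟩
  · refine (isTranscendenceBasis_equiv' (Equiv.sumComm (Fin a) (Fin b)) ?_).2 (hf.sumElim_comp hg)
    ext (i | i) <;> rfl
  · have := hf.isAlgebraic
    obtain ⟨q, hq0, hq⟩ := hf.1.exists_eval₂_eq_zero (this.isAlgebraic (xs i))
    refine ⟨q, hq0, ?_⟩
    have h := congrArg S.val hq
    rw [map_zero] at h
    rw [← h]
    change _ = S.val.toRingHom _
    rw [Polynomial.hom_eval₂]
    change Polynomial.eval₂ _ (x i) q = Polynomial.eval₂ _ (x i) q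
    congr 1
    ext j <;> simp [xs]

/-- Let the points of `A` give points of `Z`, let generic values of the coordinates `f`, `g` be
attained at such points, and let every coordinate of the base be algebraic over the coordinates
`f`. Then the points whose fibre projects densely along `g` project densely along `f`. -/
theorem denseProj_setOf_denseProj_of_algHom {A : Type*} [CommRing A] [Algebra K A] [IsAlgClosed K]
    [Finite ι] [Finite α] [Finite β] {Z : Set (ι ⊕ κ → K)} {x : ι → A} {y : κ → A}
    (hZ : ∀ φ : A →ₐ[K] K, Sum.elim (φ ∘ x) (φ ∘ y) ∈ Z) {f : α → ι} {g : β → κ}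
    {p : MvPolynomial (α ⊕ β) K} (hp0 : p ≠ 0)
    (hp : ∀ c, eval c p ≠ 0 → ∃ φ : A →ₐ[K] K, ∀ i, φ (Sum.elim (x ∘ f) (y ∘ g) i) = c i)
    (hq : ∀ i, ∃ q : Polynomial (MvPolynomial α K), q ≠ 0 ∧
        q.eval₂ (aeval (x ∘ f) : MvPolynomial α K →ₐ[K] A).toRingHom (x i) = 0) :
    DenseProj {w | DenseProj {v | Sum.elim w v ∈ Z} g} f := by
  have := Fintype.ofFinite ι
  obtain ⟨e, he⟩ := exists_sum_mvPolynomial_equiv K α β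
  obtain ⟨m, hm⟩ : ∃ m, coeff m (e p) ≠ 0 := by
    by_contra! h
    exact hp0 ((map_eq_zero_iff e e.injective).1 (MvPolynomial.ext _ _ (by simpa using h)))
  choose q hq0 hq using hq
  intro r hr
  by_contra hr0
  -- Choose a value `c` of the coordinates `f` at which `r` does not vanish, at which generic values
  -- of the coordinates `g` are still attained, and at which the algebraic equations of the coordinates
  -- of the base remain nontrivial.
  have hprod : r * coeff m (e p) * ∏ i, (q i).leadingCoeff ≠ 0 :=
    mul_ne_zero (mul_ne_zero hr0 hm) (Finset.prod_ne_zero_iff.2 fun i _ =>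
      Polynomial.leadingCoeff_ne_zero.2 (hq0 i))
  obtain ⟨c, hc⟩ : ∃ c, eval c (r * coeff m (e p) * ∏ i, (q i).leadingCoeff) ≠ 0 := by
    by_contra! h
    exact hprod (MvPolynomial.funext fun c => by rw [h c, map_zero])
  simp only [map_mul, map_prod, mul_ne_zero_iff, Finset.prod_ne_zero_iff] at hc
  obtain ⟨⟨hcr, hcm⟩, hcq⟩ := hc
  -- The finitely many candidates for points of the base over `c`.
  let W : Set (ι → K) := {w | (∀ i, w i ∈ ((q i).map (eval c)).rootSet K) ∧ w ∘ f = c}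
  have hW : W.Finite := by
    refine (Set.Finite.pi' fun i => Polynomial.rootSet_finite ((q i).map (eval c)) K).subset ?_
    exact fun w hw => hw.1
  have : Finite W := hW
  have hqc (i) : (q i).map (eval c) ≠ 0 := by
    intro h
    have := congrArg (fun u => u.coeff (q i).natDegree) h
    simp only [Polynomial.coeff_map, Polynomial.coeff_zero] at this
    exact hcq i (Finset.mem_univ i) this
  have hdense : DenseProj (⋃ w : W, {v | Sum.elim (w : ι → K) v ∈ Z}) g := by
    intro s hs
    have h0 : map (eval c) (e p) ≠ 0 := by
      intro h
      have := congrArg (coeff m) h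
      rw [coeff_map, coeff_zero] at this
      exact hcm this
    refine (mul_eq_zero.1 (MvPolynomial.funext fun d => ?_ :
      s * map (eval c) (e p) = 0)).resolve_right h0
    rw [map_mul, map_zero, mul_eq_zero, or_iff_not_imp_right]
    intro hd
    rw [← he] at hd
    obtain ⟨φ, hφ⟩ := hp _ hd
    have hf : (φ ∘ x) ∘ f = c := funext fun i => hφ (Sum.inl i)
    have hg : (φ ∘ y) ∘ g = d := funext fun i => hφ (Sum.inr i)
    rw [← hg]
    refine hs _ (Set.mem_iUnion.2 ⟨⟨φ ∘ x, fun i => ?_, hf⟩, hZ φ⟩)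
    rw [Polynomial.mem_rootSet_of_ne (hqc i), Polynomial.coe_aeval_eq_eval, Polynomial.eval_map]
    have h := congrArg φ (hq i)
    rw [map_zero] at h
    rw [← h]
    change _ = φ.toRingHom _
    rw [Polynomial.hom_eval₂]
    change Polynomial.eval₂ _ (φ (x i)) _ = Polynomial.eval₂ _ (φ (x i)) _
    congr 1
    ext j
    · simp
    · simpa using (congrFun hf j).symm
  obtain ⟨w, hw⟩ := hdense.exists_of_iUnion
  refine hcr ?_
  rw [← w.2.2]
  exact hr _ hw

/-- A dense projection of a closed set `Z` gives a dense projection, along at least as many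
coordinates in total, that is compatible with the projection to the base. -/
theorem exists_denseProj_setOf_denseProj [IsAlgClosed K] [Finite ι] [Finite κ] [Fintype α]
    {I : Ideal (MvPolynomial (ι ⊕ κ) K)} {h : α → ι ⊕ κ} (hZ : DenseProj (zeroLocus K I) h) :
    ∃ (a b : ℕ) (f : Fin a → ι) (g : Fin b → κ), Fintype.card α ≤ a + b ∧
      DenseProj {w | DenseProj {y | Sum.elim w y ∈ zeroLocus K I} g} f := by
  obtain ⟨P, hP, hIP, hind⟩ :=
    exists_isPrime_algebraicIndependent (denseProj_iff_algebraicIndependent.1 hZ)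
  replace hIP := (le_vanishingIdeal_zeroLocus I).trans hIP
  let x : ι → MvPolynomial (ι ⊕ κ) K ⧸ P := fun i => Ideal.Quotient.mk P (X (Sum.inl i))
  let y : κ → MvPolynomial (ι ⊕ κ) K ⧸ P := fun i => Ideal.Quotient.mk P (X (Sum.inr i))
  have hxy : Sum.elim x y = fun i => Ideal.Quotient.mk P (X i) := by ext (i | i) <;> rfl
  obtain ⟨a, b, f, g, hfg, hq⟩ := exists_isTranscendenceBasis_sum_elim (x := x) (y := y)
    (by rw [hxy]; exact adjoin_range_mk_X P)
  obtain ⟨p, hp0, hp⟩ := exists_ne_zero_forall_exists_algHom hfg.1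
  refine ⟨a, b, f, g, ?_, denseProj_setOf_denseProj_of_algHom (fun φ => ?_) hp0 hp hq⟩
  · have h1 := hind.lift_cardinalMk_le_trdeg
    have h2 := hfg.lift_cardinalMk_eq_trdeg
    simp at h1 h2
    rw [← h2] at h1
    exact_mod_cast h1
  · rw [mem_zeroLocus_iff]
    intro r hr
    have : (aeval (Sum.elim (φ ∘ x) (φ ∘ y)) : MvPolynomial (ι ⊕ κ) K →ₐ[K] K) =
        φ.comp (Ideal.Quotient.mkₐ K P) := by
      ext (i | i) <;> simp [x, y]
    rw [this, AlgHom.comp_apply, Ideal.Quotient.mkₐ_eq_mk,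
      Ideal.Quotient.eq_zero_iff_mem.2 (hIP hr), map_zero]

end Fibres

/-! ### Codimension and fibres -/

section Codim

open MvPolynomial

variable {K ι κ α β : Type*} [Field K]

theorem denseProj_of_image_eq_univ [Infinite K] {S : Set (ι → K)} {f : α → ι}
    (h : ∀ c : α → K, ∃ x ∈ S, x ∘ f = c) : DenseProj S f := by
  intro p hp
  refine MvPolynomial.funext fun c => ?_
  obtain ⟨x, hx, rfl⟩ := h c
  rw [hp x hx, map_zero]

theorem affineCodim_univ [Infinite K] [Fintype ι] :
    affineCodim (Set.univ : Set (ι → K)) = 0 := by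
  have h : DenseProj (Set.univ : Set (ι → K)) id :=
    denseProj_of_image_eq_univ fun c => ⟨c, trivial, rfl⟩
  have := h.affineCodim_add_card_le
  omega

theorem affineCodim_reindex_le [Fintype ι] [Fintype κ] (e : ι ≃ κ) {S : Set (ι → K)}
    (hS : S.Nonempty) : affineCodim {x : κ → K | x ∘ e ∈ S} ≤ affineCodim S := by
  obtain ⟨d, f, hf, -, hd⟩ := exists_denseProj_affineCodim hS
  have h : DenseProj {x : κ → K | x ∘ e ∈ S} (e ∘ f) := by
    intro p hp
    refine hf p fun x hx => ?_
    have := hp (x ∘ e.symm) (by simpa [Function.comp_assoc] using hx)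
    rw [← Function.comp_assoc, Function.comp_assoc x] at this
    simpa using this
  have := h.affineCodim_add_card_le
  rw [← Fintype.card_congr e, Fintype.card_fin] at this
  omega

theorem affineCodim_reindex [Fintype ι] [Fintype κ] (e : ι ≃ κ) {S : Set (ι → K)}
    (hS : S.Nonempty) : affineCodim {x : κ → K | x ∘ e ∈ S} = affineCodim S := by
  refine le_antisymm (affineCodim_reindex_le e hS) ?_
  have hne : {x : κ → K | x ∘ e ∈ S}.Nonempty := by
    obtain ⟨x, hx⟩ := hS
    exact ⟨x ∘ e.symm, by simpa [Function.comp_assoc] using hx⟩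
  have := affineCodim_reindex_le e.symm hne
  simpa [Function.comp_assoc] using this

/-- The points of the base whose fibres have codimension at most `j` bound the codimension of `Z`.
This holds for arbitrary `Z`, closed or not. -/
theorem affineCodim_le_affineCodim_add [Fintype ι] [Fintype κ] {Z : Set (ι ⊕ κ → K)}
    (hne : ∀ w, {v | Sum.elim w v ∈ Z}.Nonempty) {j : ℕ}
    (hj : {w | affineCodim {v | Sum.elim w v ∈ Z} ≤ j}.Nonempty) :
    affineCodim Z ≤ affineCodim {w | affineCodim {v | Sum.elim w v ∈ Z} ≤ j} + j := by
  set S := {w | affineCodim {v | Sum.elim w v ∈ Z} ≤ j} with hS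
  obtain ⟨d, f, hf, -, hd⟩ := exists_denseProj_affineCodim hj
  -- The coordinates along which a fibre projects densely depend on the fibre, but there are only
  -- finitely many choices of them, and one of these serves for a dense part of the base.
  let B := Σ b : Fin (Fintype.card κ + 1), Fin b → κ
  have hcov : S ⊆ ⋃ b : B, {w ∈ S | DenseProj {v | Sum.elim w v ∈ Z} b.2 ∧
      Fintype.card κ ≤ b.1 + j} := by
    intro w hw
    obtain ⟨b, g, hg, -, hb⟩ := exists_denseProj_affineCodim (hne w)
    refine Set.mem_iUnion.2 ⟨⟨⟨b, by omega⟩, g⟩, hw, hg, ?_⟩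
    have : affineCodim {v | Sum.elim w v ∈ Z} ≤ j := hw
    change Fintype.card κ ≤ b + j
    omega
  obtain ⟨⟨b, g⟩, hbg⟩ := (hf.mono hcov).exists_of_iUnion
  obtain ⟨w, -, -, hw⟩ := hbg.nonempty
  have h := (hbg.sum_map (Z := Z) (g := g) fun w hw => hw.2.1).affineCodim_add_card_le
  simp only [Fintype.card_sum, Fintype.card_fin] at h
  change Fintype.card κ ≤ b + j at hw
  omega

/-- For closed `Z` the bound of `affineCodim_le_affineCodim_add` is attained. -/
theorem exists_affineCodim_add_le [IsAlgClosed K] [Fintype ι] [Fintype κ]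
    {I : Ideal (MvPolynomial (ι ⊕ κ) K)} (hne : (zeroLocus K I).Nonempty) :
    ∃ j, {w | affineCodim {v | Sum.elim w v ∈ zeroLocus K I} ≤ j}.Nonempty ∧
      affineCodim {w | affineCodim {v | Sum.elim w v ∈ zeroLocus K I} ≤ j} + j ≤
        affineCodim (zeroLocus K I) := by
  obtain ⟨d, h, hh, -, hd⟩ := exists_denseProj_affineCodim hne
  obtain ⟨a, b, f, g, hab, hfg⟩ := exists_denseProj_setOf_denseProj hh
  rw [Fintype.card_fin] at hab
  rw [Fintype.card_sum] at hd
  have hb : b ≤ Fintype.card κ := by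
    obtain ⟨w, hw⟩ := hfg.nonempty
    have := DenseProj.affineCodim_add_card_le hw
    rw [Fintype.card_fin] at this
    omega
  have hfg' : DenseProj {w | affineCodim {v | Sum.elim w v ∈ zeroLocus K I} ≤
      Fintype.card κ - b} f := by
    refine hfg.mono fun w hw => ?_
    have := DenseProj.affineCodim_add_card_le hw
    rw [Fintype.card_fin] at this
    change affineCodim _ ≤ _
    omega
  refine ⟨Fintype.card κ - b, hfg'.nonempty, ?_⟩
  have := hfg'.affineCodim_add_card_le
  rw [Fintype.card_fin] at this
  omega

/-- The codimension of a closed set in terms of the codimensions of its fibres. Values of `j` for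
which no fibre has codimension at most `j` are excluded, since `affineCodim ∅` is a junk value. -/
theorem isLeast_affineCodim_add [IsAlgClosed K] [Fintype ι] [Fintype κ]
    {I : Ideal (MvPolynomial (ι ⊕ κ) K)} (hne : ∀ w, {v | Sum.elim w v ∈ zeroLocus K I}.Nonempty) :
    IsLeast {c | ∃ j, {w | affineCodim {v | Sum.elim w v ∈ zeroLocus K I} ≤ j}.Nonempty ∧
      c = affineCodim {w | affineCodim {v | Sum.elim w v ∈ zeroLocus K I} ≤ j} + j}
      (affineCodim (zeroLocus K I)) := by
  refine ⟨?_, ?_⟩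
  · obtain ⟨v, hv⟩ := hne 0
    obtain ⟨j, hj, hle⟩ := exists_affineCodim_add_le ⟨_, hv⟩
    exact ⟨j, hj, (affineCodim_le_affineCodim_add hne hj).antisymm hle⟩
  · rintro _ ⟨j, hj, rfl⟩
    exact affineCodim_le_affineCodim_add hne hj

theorem affineCodim_eq_of_forall_fibre [IsAlgClosed K] [Fintype ι] [Fintype κ]
    {I : Ideal (MvPolynomial (ι ⊕ κ) K)} (hne : ∀ w, {v | Sum.elim w v ∈ zeroLocus K I}.Nonempty)
    {c : ℕ}
    (hc : ∀ w, affineCodim {v | Sum.elim w v ∈ zeroLocus K I} = c) :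
    affineCodim (zeroLocus K I) = c := by
  have h := isLeast_affineCodim_add hne
  simp only [hc] at h
  refine le_antisymm (h.2 ⟨c, by simp, by simp [affineCodim_univ]⟩) ?_
  obtain ⟨j, ⟨w, hj⟩, hcj⟩ := h.1
  have : c ≤ j := hj
  omega

/-- The codimension of the kernel of a linear map is its rank. -/
theorem affineCodim_ker [Infinite K] [Fintype ι] {V : Type*} [AddCommGroup V] [Module K V]
    (φ : (ι → K) →ₗ[K] V) :
    affineCodim {x | φ x = 0} = Module.finrank K (LinearMap.range φ) := by
  have hrk := φ.finrank_range_add_finrank_ker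
  rw [Module.finrank_fintype_fun_eq_card] at hrk
  set L := LinearMap.ker φ with hL
  have hLs : {x | φ x = 0} = (L : Set (ι → K)) := by ext; simp [hL]
  rw [hLs]
  refine le_antisymm ?_ ?_
  · let c : ι → Module.Dual K L := fun i => (LinearMap.proj i).comp L.subtype
    -- Independent coordinate functionals on the kernel identify it with `K^α`.
    obtain ⟨α, a, ha, hspan, hli⟩ := exists_linearIndependent' K c
    have := Fintype.ofInjective a ha
    have hinj : Function.Injective (LinearMap.pi (c ∘ a)) := by
      rw [← LinearMap.ker_eq_bot, LinearMap.ker_eq_bot']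
      intro x hx
      have hle : Submodule.span K (Set.range (c ∘ a)) ≤
          LinearMap.ker (Module.Dual.eval K L x) := by
        rw [Submodule.span_le]
        rintro _ ⟨i, rfl⟩
        exact congrFun hx i
      ext i
      have hi : c i ∈ Submodule.span K (Set.range (c ∘ a)) := by
        rw [hspan]
        exact Submodule.subset_span ⟨i, rfl⟩
      exact hle hi
    have hcard : Fintype.card α = Module.finrank K L := by
      refine le_antisymm ?_ ?_
      · rw [← Subspace.dual_finrank_eq]
        exact hli.fintype_card_le_finrank
      · simpa using LinearMap.finrank_le_finrank_of_injective hinj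
    have hsurj := (LinearMap.injective_iff_surjective_of_finrank_eq_finrank
      (by simp [hcard])).1 hinj
    have hd : DenseProj (L : Set (ι → K)) a := denseProj_of_image_eq_univ fun y => by
      obtain ⟨x, hx⟩ := hsurj y
      exact ⟨x, x.2, hx⟩
    have := hd.affineCodim_add_card_le
    omega
  · obtain ⟨d, f, hf, -, hd⟩ :=
      exists_denseProj_affineCodim (S := (L : Set (ι → K))) ⟨0, L.zero_mem⟩
    let ψ : L →ₗ[K] (Fin d → K) := (LinearMap.funLeft K K f).comp L.subtype
    -- A proper subspace of `K^d` lies in a hyperplane, so it is not Zariski dense.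
    have hψ : LinearMap.range ψ = ⊤ := by
      by_contra hne
      obtain ⟨θ, hθ0, hθ⟩ := Submodule.exists_le_ker_of_lt_top _ (lt_top_iff_ne_top.2 hne)
      refine hθ0 ?_
      have hp := hf (∑ i, C (θ (Pi.single i 1)) * X i) fun x hx => by
        have h1 : θ (x ∘ f) = 0 := hθ ⟨⟨x, hx⟩, rfl⟩
        rw [← h1]
        conv_rhs => rw [LinearMap.pi_apply_eq_sum_univ θ]
        simp only [map_sum, map_mul, eval_C, eval_X, smul_eq_mul]
        refine Finset.sum_congr rfl fun i _ => ?_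
        rw [mul_comm]
        congr 2
        ext j
        simp [Pi.single_apply, eq_comm]
      ext i
      have := congrArg (eval (Pi.single i 1)) hp
      simpa [Pi.single_apply] using this
    have := LinearMap.finrank_range_le ψ
    rw [hψ, finrank_top, Module.finrank_fintype_fun_eq_card, Fintype.card_fin] at this
    omega

end Codim

/-! ### Zero sets of multilinear forms -/

section Multilinear

open MvPolynomial

variable {K I : Type*} [Field K] {m : I → ℕ}

/-- The points at which the multilinear form `F` vanishes whatever is put in place of the argument
`e`. The coordinates of that argument are kept as free ones, so that the sets for different `e` lie
in the same affine space. -/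
def zeroSetAt [DecidableEq I] (F : MultilinearMap K (fun i => Fin (m i) → K) K) (e : I) :
    Set ((Σ k, Fin (m k)) → K) :=
  {x | ∀ y, F (Function.update (fun k a => x ⟨k, a⟩) e y) = 0}

theorem mem_zeroSetAt_of_forall_eq_zero [DecidableEq I]
    (F : MultilinearMap K (fun i => Fin (m i) → K) K) {e k : I} (h : k ≠ e)
    {x : (Σ k, Fin (m k)) → K} (hx : ∀ a, x ⟨k, a⟩ = 0) : x ∈ zeroSetAt F e := fun y =>
  F.map_coord_zero k (by rw [Function.update_of_ne h]; exact funext hx)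

theorem zeroSetAt_nonempty [DecidableEq I] (F : MultilinearMap K (fun i => Fin (m i) → K) K)
    {e k : I} (h : k ≠ e) : (zeroSetAt F e).Nonempty :=
  ⟨0, mem_zeroSetAt_of_forall_eq_zero F h fun _ => rfl⟩

/-- A multilinear form is a polynomial function of the coordinates of its arguments. -/
theorem MultilinearMap.exists_mvPolynomial_eval_eq [Fintype I]
    (F : MultilinearMap K (fun i => Fin (m i) → K) K) :
    ∃ p : MvPolynomial (Σ k, Fin (m k)) K, ∀ x, eval x p = F fun k a => x ⟨k, a⟩ := by
  classical
  refine ⟨∑ r : ∀ k, Fin (m k), C (F fun k => Pi.single (r k) 1) * ∏ k, X ⟨k, r k⟩, fun x => ?_⟩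
  have hx : (fun k a => x ⟨k, a⟩ : ∀ k, Fin (m k) → K) =
      fun k => ∑ a, x ⟨k, a⟩ • (Pi.single a 1 : Fin (m k) → K) := by
    ext k a
    simp [Pi.single_apply]
  rw [hx, F.map_sum]
  simp only [F.map_smul_univ, _root_.map_sum, _root_.map_mul, _root_.map_prod, eval_C, eval_X,
    smul_eq_mul]
  exact Finset.sum_congr rfl fun r _ => mul_comm _ _

/-- Up to a change of the index set of the coordinates, `zeroSetAt F e` is closed. -/
theorem exists_zeroLocus_eq_zeroSetAt [Fintype I] [DecidableEq I]
    (F : MultilinearMap K (fun i => Fin (m i) → K) K) (e : I) {A : Type*}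
    (f : (Σ k, Fin (m k)) → A) :
    ∃ J : Ideal (MvPolynomial A K), {x | x ∘ f ∈ zeroSetAt F e} = zeroLocus K J := by
  obtain ⟨p, hp⟩ := F.exists_mvPolynomial_eval_eq
  -- Substitute the constants `y` for the coordinates of the argument `e`.
  let g (y : Fin (m e) → K) (q : Σ k, Fin (m k)) : MvPolynomial A K :=
    Function.update (β := fun k => Fin (m k) → MvPolynomial A K)
      (fun k a => X (f ⟨k, a⟩)) e (fun a => C (y a)) q.1 q.2
  refine ⟨Ideal.span (Set.range fun y => aeval (g y) p), ?_⟩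
  rw [zeroLocus_span]
  ext x
  simp only [zeroSetAt, Set.mem_ofPred_eq, Set.forall_mem_range]
  refine forall_congr' fun y => ?_
  have : aeval x (aeval (g y) p) = eval (fun q => aeval x (g y q)) p := by
    rw [← AlgHom.comp_apply, comp_aeval, ← coe_aeval_eq_eval]
    rfl
  rw [this, hp]
  have h : (fun k a => aeval x (g y ⟨k, a⟩)) =
      Function.update (fun k a => (x ∘ f) ⟨k, a⟩) e y := by
    ext k a
    by_cases hk : k = e
    · subst hk; simp [g]
    · simp [g, Function.update_of_ne hk]
  rw [h]

/-- The bilinear form in the arguments `i` and `j` obtained by fixing all other arguments of `F` at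
`z`. -/
def MultilinearMap.pairing [DecidableEq I] (F : MultilinearMap K (fun i => Fin (m i) → K) K)
    (z : ∀ k, Fin (m k) → K) {i j : I} (hij : i ≠ j) :
    (Fin (m i) → K) →ₗ[K] (Fin (m j) → K) →ₗ[K] K :=
  LinearMap.mk₂ K (fun u v => F (Function.update (Function.update z i u) j v))
    (fun u u' v => by simp only [Function.update_comm hij, F.map_update_add])
    (fun c u v => by simp only [Function.update_comm hij, F.map_update_smul])
    (fun u v v' => F.map_update_add _ j v v')
    (fun c u v => F.map_update_smul _ j c v)

theorem MultilinearMap.pairing_flip [DecidableEq I]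
    (F : MultilinearMap K (fun i => Fin (m i) → K) K) (z : ∀ k, Fin (m k) → K) {i j : I}
    (hij : i ≠ j) : (F.pairing z hij).flip = F.pairing z hij.symm := by
  ext u v
  simp [MultilinearMap.pairing, Function.update_comm hij]

theorem LinearMap.finrank_range_flip_eq {U V : Type*} [AddCommGroup U] [Module K U]
    [AddCommGroup V] [Module K V] [FiniteDimensional K U] [FiniteDimensional K V]
    (B : U →ₗ[K] V →ₗ[K] K) :
    Module.finrank K (LinearMap.range B.flip) = Module.finrank K (LinearMap.range B) := by
  have h : B.flip = B.dualMap ∘ₗ (Module.evalEquiv K V : V →ₗ[K] _) := by ext; simp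
  rw [h, LinearMap.range_comp_of_range_eq_top _ (LinearEquiv.range _),
    LinearMap.finrank_range_dualMap_eq_finrank_range]

/-- With all arguments other than `i` and `j` fixed, `zeroSetAt F j` becomes the left kernel of the
bilinear form in the arguments `i` and `j`, times the space of free arguments `j`; so its
codimension is the rank of this form. -/
theorem affineCodim_fibre_zeroSetAt [Infinite K] [Fintype I] [DecidableEq I]
    (F : MultilinearMap K (fun i => Fin (m i) → K) K) {i j : I} (hij : i ≠ j)
    {P : (Σ k, Fin (m k)) → Prop} [DecidablePred P] (hP : ∀ q, P q ↔ q.1 ≠ i ∧ q.1 ≠ j)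
    (w : {q // P q} → K) :
    affineCodim {v | Sum.elim w v ∘ (Equiv.sumCompl P).symm ∈ zeroSetAt F j} =
      Module.finrank K (LinearMap.range (F.pairing
        (fun k a => (Sum.elim w (0 : {q // ¬ P q} → K) ∘ (Equiv.sumCompl P).symm) ⟨k, a⟩)
        hij)) := by
  have hi (a : Fin (m i)) : ¬ P ⟨i, a⟩ := by simp [hP]
  let ρ : ({q // ¬ P q} → K) →ₗ[K] (Fin (m i) → K) :=
    LinearMap.funLeft K K fun a => ⟨⟨i, a⟩, hi a⟩
  have hρ : LinearMap.range ρ = ⊤ := by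
    rw [LinearMap.range_eq_top]
    refine LinearMap.funLeft_surjective_of_injective K K _ fun a b hab => ?_
    simpa using hab
  rw [← LinearMap.range_comp_of_range_eq_top _ hρ, ← affineCodim_ker]
  congr 1
  ext v
  simp only [zeroSetAt, Set.mem_ofPred_eq]
  rw [LinearMap.ext_iff]
  refine forall_congr' fun y => ?_
  simp only [MultilinearMap.pairing, LinearMap.comp_apply, LinearMap.mk₂_apply,
    LinearMap.zero_apply]
  refine Eq.congr_left (congrArg F ?_)
  ext k a
  by_cases hkj : k = j
  · subst hkj; simp
  rw [Function.update_of_ne hkj, Function.update_of_ne hkj]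
  by_cases hki : k = i
  · subst hki
    simp [Equiv.sumCompl_symm_apply_of_neg (hi a), ρ, LinearMap.funLeft_apply]
  · have hPk : P ⟨k, a⟩ := (hP _).2 ⟨hki, hkj⟩
    rw [Function.update_of_ne hki]
    simp [Equiv.sumCompl_symm_apply_of_pos hPk]

/-- The codimension of `zeroSetAt F i` does not depend on `i`, as a bilinear form and its transpose
have the same rank. -/
theorem affineCodim_zeroSetAt_eq [IsAlgClosed K] [Fintype I] [DecidableEq I]
    (F : MultilinearMap K (fun i => Fin (m i) → K) K) (i j : I) :
    affineCodim (zeroSetAt F i) = affineCodim (zeroSetAt F j) := by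
  rcases eq_or_ne i j with rfl | hij
  · rfl
  let P : (Σ k, Fin (m k)) → Prop := fun q => q.1 ≠ i ∧ q.1 ≠ j
  let θ := (Equiv.sumCompl P).symm
  rw [← affineCodim_reindex θ (zeroSetAt_nonempty F hij.symm),
    ← affineCodim_reindex θ (zeroSetAt_nonempty F hij)]
  obtain ⟨Ji, hJi⟩ := exists_zeroLocus_eq_zeroSetAt F i θ
  obtain ⟨Jj, hJj⟩ := exists_zeroLocus_eq_zeroSetAt F j θ
  have hci (w) := affineCodim_fibre_zeroSetAt F hij.symm (P := P) (fun _ => and_comm) w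
  have hcj (w) := affineCodim_fibre_zeroSetAt F hij (P := P) (fun _ => Iff.rfl) w
  have hc (w) : affineCodim {v | Sum.elim w v ∈ zeroLocus K Ji} =
      affineCodim {v | Sum.elim w v ∈ zeroLocus K Jj} := by
    rw [← hJi, ← hJj]
    refine (hci w).trans (Eq.trans ?_ (hcj w).symm)
    rw [← F.pairing_flip, LinearMap.finrank_range_flip_eq]
  have hnei (w) : {v | Sum.elim w v ∈ zeroLocus K Ji}.Nonempty := by
    refine ⟨0, ?_⟩
    rw [← hJi]
    exact mem_zeroSetAt_of_forall_eq_zero F hij.symm fun a => by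
      simp [θ, P, Equiv.sumCompl_symm_apply_of_neg]
  have hnej (w) : {v | Sum.elim w v ∈ zeroLocus K Jj}.Nonempty := by
    refine ⟨0, ?_⟩
    rw [← hJj]
    exact mem_zeroSetAt_of_forall_eq_zero F hij fun a => by
      simp [θ, P, Equiv.sumCompl_symm_apply_of_neg]
  have h1 := isLeast_affineCodim_add hnei
  have h2 := isLeast_affineCodim_add hnej
  simp only [hc] at h1
  rw [hJi, hJj]
  exact h1.unique h2

end Multilinear

/-! ### Geometric rank -/

section GeometricRank

open MvPolynomial

variable {K I J : Type*} [Field K] {m : I → ℕ}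

/-- The coordinates of all arguments, split into those of the argument `p` and those of the other
arguments, the latter being enumerated by `s`. -/
noncomputable def sigmaFinSumEquiv (m : I → ℕ) {p : I} {s : J → I} (hs : Function.Injective s)
    (hp : Set.range s = {p}ᶜ) : Fin (m p) ⊕ (Σ j, Fin (m (s j))) ≃ Σ k, Fin (m k) :=
  have hsp (j) : s j ≠ p := by
    have : s j ∈ ({p}ᶜ : Set I) := hp ▸ ⟨j, rfl⟩
    exact this
  Equiv.ofBijective (Sum.elim (fun a => ⟨p, a⟩) fun q => ⟨s q.1, q.2⟩) <| by
    refine ⟨?_, ?_⟩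
    · rintro (a | ⟨j, a⟩) (b | ⟨j', b⟩) h
      · simpa using h
      · exact absurd (congrArg Sigma.fst h).symm (hsp j')
      · exact absurd (congrArg Sigma.fst h) (hsp j)
      · obtain rfl : j = j' := hs (congrArg Sigma.fst h)
        simpa using h
    · rintro ⟨k, a⟩
      by_cases hk : k = p
      · subst hk
        exact ⟨Sum.inl a, rfl⟩
      · obtain ⟨j, rfl⟩ : k ∈ Set.range s := by rw [hp]; exact hk
        exact ⟨Sum.inr ⟨j, a⟩, rfl⟩

@[simp]
theorem sigmaFinSumEquiv_symm_self {p : I} {s : J → I} (hs : Function.Injective s)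
    (hp : Set.range s = {p}ᶜ) (a : Fin (m p)) :
    (sigmaFinSumEquiv m hs hp).symm ⟨p, a⟩ = Sum.inl a :=
  (Equiv.symm_apply_eq _).2 rfl

@[simp]
theorem sigmaFinSumEquiv_symm_apply {p : I} {s : J → I} (hs : Function.Injective s)
    (hp : Set.range s = {p}ᶜ) (j : J) (a : Fin (m (s j))) :
    (sigmaFinSumEquiv m hs hp).symm ⟨s j, a⟩ = Sum.inr ⟨j, a⟩ :=
  (Equiv.symm_apply_eq _).2 rfl

/-- The geometric rank can be computed from any argument `i`, not only from the last one, and in the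
full affine space. For the last argument, `zeroSetAt` is the product of `tensorZeroSet` with an
affine space. -/
theorem geometricRank_eq_affineCodim_zeroSetAt [IsAlgClosed K] {n : ℕ} {m : Fin (n + 2) → ℕ}
    (F : MultilinearMap K (fun i => Fin (m i) → K) K) (i : Fin (n + 2)) :
    geometricRank F = affineCodim (zeroSetAt F i) := by
  rw [affineCodim_zeroSetAt_eq F i (Fin.last (n + 1))]
  let θ := (sigmaFinSumEquiv m (Fin.castSucc_injective (n + 1)) (p := Fin.last (n + 1))
    (by ext k; exact Fin.exists_castSucc_eq)).symm
  have h0 : (0 : Fin (n + 2)) ≠ Fin.last (n + 1) := (Fin.last_pos).ne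
  rw [← affineCodim_reindex θ (zeroSetAt_nonempty F h0)]
  obtain ⟨I, hI⟩ := exists_zeroLocus_eq_zeroSetAt F (Fin.last (n + 1)) θ
  have hfib (u : Fin (m (Fin.last (n + 1))) → K) :
      {v | Sum.elim u v ∈ zeroLocus K I} = tensorZeroSet F := by
    rw [← hI]
    ext v
    refine forall_congr' fun y => Eq.congr_left (congrArg F ?_)
    ext k a
    induction k using Fin.lastCases with
    | last => simp
    | cast k => simp [θ]
  rw [hI, affineCodim_eq_of_forall_fibre (c := geometricRank F)]
  · intro w
    rw [hfib]
    refine ⟨0, fun y => F.map_coord_zero (Fin.castSucc 0) ?_⟩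
    simp only [Fin.snoc_castSucc]
    rfl
  · intro w
    rw [hfib, geometricRank]

theorem affineCodim_zeroSetAt_reindex [Infinite K] [Fintype I] [DecidableEq I] [Fintype J]
    [DecidableEq J] (σ : J ≃ I) (F : MultilinearMap K (fun i => Fin (m i) → K) K)
    (G : MultilinearMap K (fun j => Fin (m (σ j)) → K) K) (hG : ∀ z, G (fun j => z (σ j)) = F z)
    {i : J} {k : J} (hk : k ≠ i) :
    affineCodim (zeroSetAt G i) = affineCodim (zeroSetAt F (σ i)) := by
  let θ : (Σ j, Fin (m (σ j))) ≃ Σ k, Fin (m k) := Equiv.sigmaCongrLeft (β := fun k => Fin (m k)) σ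
  rw [← affineCodim_reindex θ (zeroSetAt_nonempty G hk)]
  congr 1
  ext x
  refine forall_congr' fun y => ?_
  rw [← hG]
  refine Eq.congr_left (congrArg G ?_)
  ext j a
  by_cases hj : j = i
  · subst hj; simp
  · rw [Function.update_of_ne hj, Function.update_of_ne (σ.injective.ne hj)]
    rfl

theorem tensorForm_reindex {n : ℕ} {m : Fin n → ℕ} (σ : Equiv.Perm (Fin n))
    (T : ⨂[K] i, (Fin (m i) → K)) (z : ∀ i, Fin (m i) → K) :
    tensorForm (m := fun i => m (σ.symm i))
      (PiTensorProduct.reindex K (fun i => Fin (m i) → K) σ T) (fun i => z (σ.symm i)) =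
    tensorForm T z := by
  induction T using PiTensorProduct.induction_on with
  | smul_tprod r a =>
    rw [map_smul, PiTensorProduct.reindex_tprod]
    have h1 := tensorForm_tprod (K := K) (m := fun i => m (σ.symm i))
      (fun i => a (σ.symm i)) (fun i => z (σ.symm i))
    have h2 := tensorForm_tprod a z
    simp only [tensorForm, MultilinearMap.coe_mk, map_smul] at h1 h2 ⊢
    rw [h1, h2, Equiv.prod_comp σ.symm fun i => z i ⬝ᵥ a i]
  | add S T hS hT =>
    simp only [tensorForm, MultilinearMap.coe_mk, map_add] at hS hT ⊢
    rw [hS, hT]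

/-- The points whose `k`-th argument is zero lie in `zeroSetAt F i`. -/
theorem affineCodim_zeroSetAt_le [Infinite K] [Fintype I] [DecidableEq I]
    (F : MultilinearMap K (fun i => Fin (m i) → K) K) {i k : I} (h : k ≠ i) :
    affineCodim (zeroSetAt F i) ≤ m k := by
  have hp : Set.range (Subtype.val : {j // j ≠ k} → I) = {k}ᶜ := by
    rw [Subtype.range_coe_subtype]; rfl
  let θ := sigmaFinSumEquiv m Subtype.val_injective hp
  have hd : DenseProj (zeroSetAt F i) (θ ∘ Sum.inr) := denseProj_of_image_eq_univ fun c => by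
    refine ⟨Sum.elim 0 c ∘ θ.symm, mem_zeroSetAt_of_forall_eq_zero F h fun a => ?_, ?_⟩
    · simp [θ]
    · ext q; simp
  have h1 := hd.affineCodim_add_card_le
  have h2 := Fintype.card_congr θ
  rw [Fintype.card_sum, Fintype.card_fin] at h2
  omega

theorem geometricRank_le [IsAlgClosed K] {n : ℕ} {m : Fin (n + 2) → ℕ}
    (F : MultilinearMap K (fun i => Fin (m i) → K) K) (k : Fin (n + 2)) :
    geometricRank F ≤ m k := by
  obtain ⟨i, hi⟩ := exists_ne k
  rw [geometricRank_eq_affineCodim_zeroSetAt F i]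
  exact affineCodim_zeroSetAt_le F hi.symm

/-- The minimum formula without the bound on `j`: project the zero set to the `i`-th argument. -/
theorem isLeast_contractionLocus [IsAlgClosed K] {n : ℕ} {m : Fin (n + 3) → ℕ}
    (F : MultilinearMap K (fun i => Fin (m i) → K) K) (i : Fin (n + 3)) :
    IsLeast {c : ℕ | ∃ j : ℕ, (contractionLocus F i j).Nonempty ∧
      c = affineCodim (contractionLocus F i j) + j} (geometricRank F) := by
  let e := i.succAbove 0
  have he : i ≠ e := (Fin.succAbove_ne i 0).symm
  let θ := (sigmaFinSumEquiv m (Fin.succAbove_right_injective (p := i)) (p := i)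
    (Fin.range_succAbove i)).symm
  rw [geometricRank_eq_affineCodim_zeroSetAt F e,
    ← affineCodim_reindex θ (zeroSetAt_nonempty F he)]
  obtain ⟨I, hI⟩ := exists_zeroLocus_eq_zeroSetAt F e θ
  have hfib (x : Fin (m i) → K) :
      {v | Sum.elim x v ∈ zeroLocus K I} =
        zeroSetAt (m := fun k => m (i.succAbove k)) (F.curryMid i x) 0 := by
    -- Inserting `x` and overwriting another argument commute.
    rw [← hI]
    ext v
    refine forall_congr' fun y => Eq.congr_left (congrArg F ?_)
    ext k a
    induction k using Fin.succAboveCases i with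
    | x => simp [Function.update_of_ne he, θ]
    | p k =>
      by_cases hk : k = 0
      · subst hk; simp [e]
      · simp [Function.update_of_ne hk, e,
          Function.update_of_ne (Fin.succAbove_right_injective.ne hk), θ]
  have h := isLeast_affineCodim_add (I := I) fun x => by
    rw [hfib]
    exact zeroSetAt_nonempty _ one_ne_zero
  simp only [hfib, ← geometricRank_eq_affineCodim_zeroSetAt] at h
  rw [hI]
  exact h

theorem zero_mem_contractionLocus [Infinite K] {n : ℕ} {m : Fin (n + 2) → ℕ}
    (F : MultilinearMap K (fun i => Fin (m i) → K) K) (i : Fin (n + 2)) (j : ℕ) :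
    0 ∈ contractionLocus F i j := by
  have h : tensorZeroSet (m := fun k => m (i.succAbove k)) (F.curryMid i 0) = Set.univ :=
    Set.eq_univ_of_forall fun x y => by simp
  change affineCodim (tensorZeroSet (m := fun k => m (i.succAbove k)) (F.curryMid i 0)) ≤ j
  rw [h, affineCodim_univ]
  exact j.zero_le

/-- Beyond the dimensions of the remaining factors the contraction loci no longer grow. -/
theorem contractionLocus_min [IsAlgClosed K] {n : ℕ} {m : Fin (n + 3) → ℕ}
    (F : MultilinearMap K (fun i => Fin (m i) → K) K) (i : Fin (n + 3)) (j : ℕ) :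
    contractionLocus F i (min j (Finset.univ.inf' Finset.univ_nonempty fun k => m (i.succAbove k)))
      = contractionLocus F i j := by
  ext x
  simp only [contractionLocus, Set.mem_ofPred_eq, le_min_iff, and_iff_left_iff_imp]
  intro _
  exact Finset.le_inf' _ _ fun k _ => geometricRank_le (m := fun k => m (i.succAbove k)) _ k

end GeometricRank

theorem proposition6p1 {K : Type*} [Field K] [IsAlgClosed K] [CharZero K]
    (n : ℕ) (m : Fin (n + 3) → ℕ) (T : ⨂[K] i, (Fin (m i) → K)) :
    (∀ σ : Equiv.Perm (Fin (n + 3)),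
      geometricRank (m := fun i => m (σ.symm i))
        (tensorForm (PiTensorProduct.reindex K (fun i => Fin (m i) → K) σ T)) =
      geometricRank (tensorForm T)) ∧
    ∀ i : Fin (n + 3),
      IsLeast
        {c : ℕ | ∃ j : ℕ, (∀ k : Fin (n + 3), k ≠ i → j ≤ m k) ∧
          c = affineCodim (contractionLocus (tensorForm T) i j) + j}
        (geometricRank (tensorForm T)) := by
  refine ⟨fun σ => ?_, fun i => ⟨?_, ?_⟩⟩
  · rw [geometricRank_eq_affineCodim_zeroSetAt _ 0,
      geometricRank_eq_affineCodim_zeroSetAt _ (σ.symm 0)]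
    exact affineCodim_zeroSetAt_reindex σ.symm _ _ (tensorForm_reindex σ T) one_ne_zero
  · have h := isLeast_contractionLocus (tensorForm T) i
    obtain ⟨j, hne, hj⟩ := h.1
    let B := Finset.univ.inf' Finset.univ_nonempty fun k => m (i.succAbove k)
    have hB : contractionLocus (tensorForm T) i (min j B) = contractionLocus (tensorForm T) i j :=
      contractionLocus_min _ i j
    refine ⟨min j B, fun k hk => ?_, le_antisymm ?_ ?_⟩
    · obtain ⟨k, rfl⟩ := Fin.exists_succAbove_eq hk
      exact (min_le_right _ _).trans (Finset.inf'_le _ (Finset.mem_univ k))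
    · exact h.2 ⟨min j B, hB ▸ hne, rfl⟩
    · rw [hB, hj]
      exact Nat.add_le_add_left (min_le_left _ _) _
  · rintro _ ⟨j, -, rfl⟩
    exact (isLeast_contractionLocus (tensorForm T) i).2
      ⟨j, ⟨0, zero_mem_contractionLocus _ i j⟩, rfl⟩
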